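/- Rings are associative and need not have a unit. A ring is locally nilpotent if each of its finitely generated subrings is nilpotent. A derivation on a ring $R$ is an additive map $D\colon R\to R$ with $D(ab)=D(a)b+aD(b)$; the differential polynomial ring $R[X;D]$ consists of the polynomials $\sum_i a_iX^i$ with $a_i\in R$, with coefficientwise addition and the multiplication determined by $X^iX^j=X^{i+j}$ and $Xa=aX+D(a)$ for $a\in R$. An element $a$ of a ring $S$ is quasi-regular if there is $b\in S$ with $a+b+ab=a+b+ba=0$, and $S$ is a Jacobson radical ring if all its elements are quasi-regular. **Theorem.** There exist a locally nilpotent ring $R$ and a derivation $D$ on $R$ such that $R[X;D]$ is not a Jacobson radical ring. More precisely, let $K$ be any field, let $A$ be the free $K$-algebra without unit on generators $x_0,x_1,x_2,\dots$, and let $D$ be the $K$-linear derivation of $A$ with $D(x_i)=x_{i+1}$ for all $i\ge 0$. For $k,n>0$ let $W(k,n)=\bigcup_{t\ge 0}D^t(M_{k,n})$, where $M_{k,n}$ is the set of all monomials $x_{i_1}x_{i_2}\cdots x_{i_n}$ of length $n$ with $0\le i_1,\dots,i_n\le k-1$. Let $I_k$ be the (two-sided, $K$-linear) ideal of $A$ generated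 by $W(k,2\cdot 100^{k^2})$, and let $I=\sum_{k>0}I_k$. Then $D(I)\subseteq I$, so that $D$ induces a derivation, also denoted by $D$, of the ring $R=A/I$; the ring $R$ is locally nilpotent; and the element $x_0X$ of $R[X;D]$ is not quasi-regular, so that $R[X;D]$ is not a Jacobson radical ring. -/

import Mathlib

/-! Rings are associative and need not have a unit (`NonUnitalRing`). -/

/-- A derivation on a ring: an additive map `D` with `D (a b) = D(a) b + a D(b)`. -/
structure RingDerivation (R : Type*) [NonUnitalRing R] extends R →+ R where
  leibniz' : ∀ a b : R, toFun (a * b) = toFun a * b + a * toFun b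

namespace RingDerivation

variable {R : Type*} [NonUnitalRing R]

instance : FunLike (RingDerivation R) R R where
  coe D := D.toFun
  coe_injective D E h := by
    cases D; cases E; congr; exact DFunLike.coe_injective h

instance : AddMonoidHomClass (RingDerivation R) R R where
  map_add D := D.map_add'
  map_zero D := D.map_zero'

theorem leibniz (D : RingDerivation R) (a b : R) : D (a * b) = D a * b + a * D b :=
  D.leibniz' a b

/-- The derivation induced on the quotient of `R` by a two-sided ideal stable under `D`. -/
def quotient (D : RingDerivation R) (I : TwoSidedIdeal R) (h : ∀ a ∈ I, D a ∈ I) :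
    RingDerivation I.ringCon.Quotient where
  toFun := Quotient.map' D fun a b hab => by
    have hab' : I.ringCon a b := hab
    rw [TwoSidedIdeal.rel_iff] at hab'
    change I.ringCon (D a) (D b)
    rw [TwoSidedIdeal.rel_iff, ← map_sub]
    exact h _ hab'
  map_zero' := congrArg (RingCon.toQuotient (c := I.ringCon)) (map_zero D)
  map_add' a b := by
    induction a using Quotient.inductionOn'
    induction b using Quotient.inductionOn'
    exact congrArg (RingCon.toQuotient (c := I.ringCon)) (map_add D _ _)
  leibniz' a b := by
    induction a using Quotient.inductionOn'
    induction b using Quotient.inductionOn'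
    exact congrArg (RingCon.toQuotient (c := I.ringCon)) (D.leibniz _ _)

@[simp] theorem quotient_coe (D : RingDerivation R) (I : TwoSidedIdeal R)
    (h : ∀ a ∈ I, D a ∈ I) (a : R) :
    D.quotient I h (a : I.ringCon.Quotient) = ((D a : R) : I.ringCon.Quotient) := rfl

end RingDerivation

/-! ### Differential polynomial rings -/

/-- The differential polynomial ring `R[X; D]`. Its elements are the polynomials `∑ aᵢ Xⁱ` with
coefficients `aᵢ ∈ R`, written as finitely supported coefficient sequences; the addition is
coefficientwise, and the product is determined by `Xⁱ Xʲ = Xⁱ⁺ʲ` and `X a = a X + D(a)`. -/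
structure DiffPoly {R : Type*} [NonUnitalRing R] (D : RingDerivation R) where
  /-- the sequence of coefficients -/
  coeff : ℕ →₀ R

namespace DiffPoly

variable {R : Type*} [NonUnitalRing R] {D : RingDerivation R}

/-- An element of `R[X; D]` is the same thing as its coefficient sequence. -/
@[simps] def equivFinsupp : DiffPoly D ≃ (ℕ →₀ R) where
  toFun := coeff
  invFun := mk

noncomputable instance : AddCommGroup (DiffPoly D) := equivFinsupp.addCommGroup

@[ext] theorem ext {p q : DiffPoly D} (h : p.coeff = q.coeff) : p = q :=
  equivFinsupp.injective h

@[simp] theorem coeff_zero : (0 : DiffPoly D).coeff = 0 := rfl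
@[simp] theorem coeff_add (p q : DiffPoly D) : (p + q).coeff = p.coeff + q.coeff := rfl

/-- The polynomial `a Xⁱ`. -/
noncomputable def monomial (D : RingDerivation R) (i : ℕ) (a : R) : DiffPoly D :=
  ⟨Finsupp.single i a⟩

theorem monomial_add (i : ℕ) (a b : R) :
    monomial D i (a + b) = monomial D i a + monomial D i b :=
  ext (Finsupp.single_add i a b)

/-- Every additive map out of `R[X; D]` is given by its values on the monomials. -/
noncomputable def liftAdd {M : Type*} [AddCommMonoid M] (f : ℕ → R →+ M) : DiffPoly D →+ M where
  toFun p := Finsupp.liftAddHom f p.coeff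
  map_zero' := map_zero _
  map_add' _ _ := map_add _ _ _

@[simp] theorem liftAdd_monomial {M : Type*} [AddCommMonoid M] (f : ℕ → R →+ M) (i : ℕ) (a : R) :
    liftAdd f (monomial D i a) = f i a := by
  simp [liftAdd, monomial]

theorem addHom_ext {M : Type*} [AddCommMonoid M] {f g : DiffPoly D →+ M}
    (h : ∀ i a, f (monomial D i a) = g (monomial D i a)) : f = g := by
  ext p
  have key : ∀ c : ℕ →₀ R, f ⟨c⟩ = g ⟨c⟩ := fun c => by
    induction c using Finsupp.induction_linear with
    | zero => exact (map_zero f).trans (map_zero g).symm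
    | add c d hc hd =>
      have e : (⟨c + d⟩ : DiffPoly D) = ⟨c⟩ + ⟨d⟩ := rfl
      rw [e, map_add, map_add, hc, hd]
    | single i a => exact h i a
  exact key p.coeff

/-- `a Xⁱ`, as an additive function of `a`. -/
noncomputable def monomialHom (D : RingDerivation R) (i : ℕ) : R →+ DiffPoly D where
  toFun := monomial D i
  map_zero' := ext (Finsupp.single_zero i)
  map_add' := monomial_add i

/-- Left multiplication by `X`: `X · (b Xʲ) = b Xʲ⁺¹ + D(b) Xʲ`. -/
noncomputable def mulX (D : RingDerivation R) : DiffPoly D →+ DiffPoly D :=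
  liftAdd fun j => monomialHom D (j + 1) + (monomialHom D j).comp D.toAddMonoidHom

/-- Left multiplication by a coefficient: `a · (b Xʲ) = (a b) Xʲ`. -/
noncomputable def mulC (D : RingDerivation R) (a : R) : DiffPoly D →+ DiffPoly D :=
  liftAdd fun j => (monomialHom D j).comp (AddMonoidHom.mulLeft a)

@[simp] theorem mulX_monomial (i : ℕ) (b : R) :
    mulX D (monomial D i b) = monomial D (i + 1) b + monomial D i (D b) :=
  liftAdd_monomial _ _ _

@[simp] theorem mulC_monomial (a : R) (i : ℕ) (b : R) :
    mulC D a (monomial D i b) = monomial D i (a * b) :=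
  liftAdd_monomial _ _ _

theorem mulC_add (a b : R) : mulC D (a + b) = mulC D a + mulC D b :=
  addHom_ext fun i c => by
    rw [AddMonoidHom.add_apply, mulC_monomial, mulC_monomial, mulC_monomial, add_mul,
      monomial_add]

theorem mulC_mul (a b : R) (q : DiffPoly D) : mulC D (a * b) q = mulC D a (mulC D b q) := by
  have : mulC D (a * b) = (mulC D a).comp (mulC D b) := addHom_ext fun i c => by
    rw [AddMonoidHom.comp_apply, mulC_monomial, mulC_monomial, mulC_monomial, mul_assoc]
  exact DFunLike.congr_fun this q

theorem mulX_mulC (a : R) (q : DiffPoly D) :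
    mulX D (mulC D a q) = mulC D a (mulX D q) + mulC D (D a) q := by
  have : (mulX D).comp (mulC D a) = (mulC D a).comp (mulX D) + mulC D (D a) :=
    addHom_ext fun i c => by
      rw [AddMonoidHom.add_apply, AddMonoidHom.comp_apply, AddMonoidHom.comp_apply]
      simp only [mulC_monomial, mulX_monomial, map_add, D.leibniz, monomial_add]
      abel
  exact DFunLike.congr_fun this q

/-- Left multiplication by `Xⁱ`. -/
noncomputable def mulXPow (D : RingDerivation R) : ℕ → (DiffPoly D →+ DiffPoly D)
  | 0 => AddMonoidHom.id _
  | i + 1 => (mulX D).comp (mulXPow D i)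

@[simp] theorem mulXPow_zero (q : DiffPoly D) : mulXPow D 0 q = q := rfl

theorem mulXPow_succ (i : ℕ) (q : DiffPoly D) :
    mulXPow D (i + 1) q = mulX D (mulXPow D i q) := rfl

/-- The product of `R[X; D]`: `(∑ aᵢ Xⁱ) · q = ∑ aᵢ · (Xⁱ · q)`. -/
noncomputable def mulHom (D : RingDerivation R) : DiffPoly D →+ DiffPoly D →+ DiffPoly D :=
  liftAdd fun i => AddMonoidHom.mk' (fun a => (mulC D a).comp (mulXPow D i)) fun a b => by
    rw [mulC_add]; rfl

noncomputable instance : Mul (DiffPoly D) := ⟨fun p q => mulHom D p q⟩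

theorem mul_def (p q : DiffPoly D) : p * q = mulHom D p q := rfl

theorem mulHom_monomial (i : ℕ) (a : R) (q : DiffPoly D) :
    mulHom D (monomial D i a) q = mulC D a (mulXPow D i q) := by
  rw [mulHom, liftAdd_monomial]; rfl

theorem mulHom_mulX (q r : DiffPoly D) : mulHom D (mulX D q) r = mulX D (mulHom D q r) := by
  have : ((mulHom D).flip r).comp (mulX D) = (mulX D).comp ((mulHom D).flip r) :=
    addHom_ext fun i a => by
      simp only [AddMonoidHom.comp_apply, AddMonoidHom.flip_apply, mulX_monomial, map_add,
        mulHom_monomial, mulX_mulC, mulXPow_succ]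
  exact DFunLike.congr_fun this q

theorem mulHom_mulXPow (i : ℕ) (q r : DiffPoly D) :
    mulHom D (mulXPow D i q) r = mulXPow D i (mulHom D q r) := by
  induction i with
  | zero => rfl
  | succ i ih => rw [mulXPow_succ, mulXPow_succ, mulHom_mulX, ih]

theorem mulHom_mulC (a : R) (q r : DiffPoly D) :
    mulHom D (mulC D a q) r = mulC D a (mulHom D q r) := by
  have : ((mulHom D).flip r).comp (mulC D a) = (mulC D a).comp ((mulHom D).flip r) :=
    addHom_ext fun i b => by
      simp only [AddMonoidHom.comp_apply, AddMonoidHom.flip_apply, mulC_monomial,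
        mulHom_monomial, mulC_mul]
  exact DFunLike.congr_fun this q

theorem mulHom_mulHom (p q r : DiffPoly D) :
    mulHom D (mulHom D p q) r = mulHom D p (mulHom D q r) := by
  have : ((mulHom D).flip r).comp ((mulHom D).flip q) = (mulHom D).flip (mulHom D q r) :=
    addHom_ext fun i a => by
      simp only [AddMonoidHom.comp_apply, AddMonoidHom.flip_apply, mulHom_monomial,
        mulHom_mulC, mulHom_mulXPow]
  exact DFunLike.congr_fun this p

noncomputable instance : NonUnitalRing (DiffPoly D) where
  __ := (inferInstance : AddCommGroup (DiffPoly D))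
  mul := (· * ·)
  left_distrib p q r := map_add (mulHom D p) q r
  right_distrib p q r := by
    simp only [mul_def, map_add]; rfl
  zero_mul p := by
    simp only [mul_def, map_zero]; rfl
  mul_zero p := map_zero (mulHom D p)
  mul_assoc p q r := mulHom_mulHom p q r

/-- `a · (b Xʲ) = (a b) Xʲ`. -/
theorem monomial_zero_mul_monomial (a b : R) (j : ℕ) :
    monomial D 0 a * monomial D j b = monomial D j (a * b) := by
  rw [mul_def, mulHom_monomial, mulXPow_zero, mulC_monomial]

/-- `(a Xⁱ⁺¹) (b Xʲ) = (a Xⁱ) (b Xʲ⁺¹ + D(b) Xʲ)`. -/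
theorem monomial_succ_mul_monomial (a b : R) (i j : ℕ) :
    monomial D (i + 1) a * monomial D j b
      = monomial D i a * (monomial D (j + 1) b + monomial D j (D b)) := by
  have h : ∀ (n : ℕ) (q : DiffPoly D), mulXPow D (n + 1) q = mulXPow D n (mulX D q) := by
    intro n q
    induction n with
    | zero => rfl
    | succ n ih => rw [mulXPow_succ, ih, ← mulXPow_succ]
  rw [mul_def, mul_def, mulHom_monomial, mulHom_monomial, h, mulX_monomial]

end DiffPoly

/-! ### Locally nilpotent rings and Jacobson radical rings -/

/-- The ring `R` is nilpotent: for some `n`, all products `a₀ a₁ ⋯ aₙ` are zero. -/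
def IsNilpotentRing (R : Type*) [NonUnitalRing R] : Prop :=
  ∃ n : ℕ, ∀ (a : R) (l : List R), l.length = n → l.foldl (· * ·) a = 0

/-- The ring `R` is locally nilpotent: every finitely generated subring is nilpotent. -/
def IsLocallyNilpotentRing (R : Type*) [NonUnitalRing R] : Prop :=
  ∀ s : Finset R, IsNilpotentRing (NonUnitalSubring.closure (s : Set R))

/-- `S` is a Jacobson radical ring, `J(S) = S`: every element of `S` is quasi-regular. -/
def IsJacobsonRadicalRing (S : Type*) [NonUnitalRing S] : Prop :=
  ∀ a : S, IsQuasiregular a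

/-! ### The ring `A / I` -/

namespace Shestakov

/-- The free (non-unital) `K`-algebra `A` on `x₀, x₁, x₂, …`: it has the nonempty words in the
letters `0, 1, 2, …` as a `K`-basis, and words are multiplied by concatenation. -/
abbrev A (K : Type*) [Field K] : Type _ := MonoidAlgebra K (FreeSemigroup ℕ)

variable (K : Type*) [Field K]

/-- The monomial belonging to a nonempty word. -/
noncomputable def mon (w : FreeSemigroup ℕ) : A K := MonoidAlgebra.single w 1

/-- The free generator `xᵢ`. -/
noncomputable def x (i : ℕ) : A K := mon K (FreeSemigroup.of i)

/-- The derivative of `xᵢ · xⱼ₁ ⋯ xⱼₙ` by the Leibniz rule, with `D(xᵢ) = xᵢ₊₁`. -/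
noncomputable def derivWord : ℕ → List ℕ → A K
  | i, [] => x K (i + 1)
  | i, j :: l => x K (i + 1) * mon K ⟨j, l⟩ + x K i * derivWord j l

/-- The derivation of `A` with `D(xᵢ) = xᵢ₊₁`, as a `K`-linear map. -/
noncomputable def derivLin : A K →ₗ[K] A K :=
  Finsupp.linearCombination K (fun w : FreeSemigroup ℕ => derivWord K w.head w.tail) ∘ₗ
    (MonoidAlgebra.coeffLinearEquiv K).toLinearMap

variable {K}

theorem mon_mul (v w : FreeSemigroup ℕ) : mon K (v * w) = mon K v * mon K w := by
  simp [mon, MonoidAlgebra.single_mul_single]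

theorem derivLin_single (w : FreeSemigroup ℕ) (c : K) :
    derivLin K (MonoidAlgebra.single w c) = c • derivWord K w.head w.tail := by
  simp [derivLin]

theorem derivLin_mon (w : FreeSemigroup ℕ) : derivLin K (mon K w) = derivWord K w.head w.tail := by
  simp [mon, derivLin_single]

theorem derivLin_x (i : ℕ) : derivLin K (x K i) = x K (i + 1) :=
  derivLin_mon _

theorem single_eq (w : FreeSemigroup ℕ) (c : K) :
    (MonoidAlgebra.single w c : A K) = c • mon K w := by
  simp [mon]

theorem derivWord_append (i : ℕ) (l : List ℕ) (w : FreeSemigroup ℕ) :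
    derivWord K i (l ++ w.head :: w.tail)
      = derivWord K i l * mon K w + mon K ⟨i, l⟩ * derivWord K w.head w.tail := by
  induction l generalizing i with
  | nil => rfl
  | cons j l ih =>
    have h1 : mon K ⟨j, l ++ w.head :: w.tail⟩ = mon K ⟨j, l⟩ * mon K w := by
      rw [← mon_mul]; rfl
    have h2 : mon K ⟨i, j :: l⟩ = x K i * mon K ⟨j, l⟩ := by
      rw [x, ← mon_mul]; rfl
    simp only [List.cons_append, derivWord, ih, h1, h2]
    simp only [add_mul, mul_add, mul_assoc, add_assoc]

theorem derivLin_leibniz (a b : A K) :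
    derivLin K (a * b) = derivLin K a * b + a * derivLin K b := by
  induction a using MonoidAlgebra.induction_linear with
  | zero => simp
  | add a a' ha ha' => simp only [add_mul, map_add, ha, ha']; abel
  | single v c =>
    induction b using MonoidAlgebra.induction_linear with
    | zero => simp
    | add b b' hb hb' => simp only [mul_add, map_add, hb, hb']; abel
    | single w d =>
      have h : derivLin K (mon K v * mon K w)
          = derivLin K (mon K v) * mon K w + mon K v * derivLin K (mon K w) := by
        rw [← mon_mul, derivLin_mon, derivLin_mon, derivLin_mon]
        exact derivWord_append v.head v.tail w
      simp only [single_eq, smul_mul_assoc, mul_smul_comm, map_smul, h, smul_add]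

variable (K)

/-- The derivation `D` of `A` with `D(xᵢ) = xᵢ₊₁`. -/
noncomputable def D : RingDerivation (A K) where
  toAddMonoidHom := (derivLin K).toAddMonoidHom
  leibniz' := derivLin_leibniz

theorem D_x (i : ℕ) : D K (x K i) = x K (i + 1) := derivLin_x i

/-- `W(k, n, l)`: for `l = 0` the set of all monomials of length `n` in `x₀, …, x_{k-1}`, and
`W(k, n, l + 1) = D(W(k, n, l))`. -/
def Wstep (k n : ℕ) : ℕ → Set (A K)
  | 0 => {a | ∃ w : FreeSemigroup ℕ,
      w.length = n ∧ (∀ i ∈ w.head :: w.tail, i < k) ∧ a = mon K w}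
  | l + 1 => D K '' Wstep k n l

/-- `W(k, n) = ⋃ₜ W(k, n, t)`. -/
def W (k n : ℕ) : Set (A K) := ⋃ t, Wstep K k n t

/-- The ideal `I_k` of the `K`-algebra `A` generated by `W(k, 2 · 100 ^ (k ^ 2))`. As `A` has no
unit, the `K`-span makes sure that the ideal is closed under scalars. -/
noncomputable def Ik (k : ℕ) : TwoSidedIdeal (A K) :=
  TwoSidedIdeal.span (Submodule.span K (W K k (2 * 100 ^ k ^ 2)) : Set (A K))

/-- The ideal `I = ∑_{k > 0} I_k`. -/
noncomputable def I : TwoSidedIdeal (A K) := ⨆ k : {k : ℕ // 0 < k}, Ik K k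

theorem D_mem_W {k n : ℕ} {a : A K} (ha : a ∈ W K k n) : D K a ∈ W K k n := by
  obtain ⟨t, ht⟩ := Set.mem_iUnion.1 ha
  exact Set.mem_iUnion.2 ⟨t + 1, a, ht, rfl⟩

theorem D_mem_span {k n : ℕ} {a : A K} (ha : a ∈ Submodule.span K (W K k n)) :
    D K a ∈ Submodule.span K (W K k n) := by
  have h : Submodule.span K (W K k n) ≤ (Submodule.span K (W K k n)).comap (derivLin K) :=
    Submodule.span_le.2 fun b hb => Submodule.subset_span (D_mem_W K hb)
  exact h ha

theorem D_mem_I : ∀ a ∈ I K, D K a ∈ I K := by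
  let J : TwoSidedIdeal (A K) := TwoSidedIdeal.mk' {a | a ∈ I K ∧ D K a ∈ I K}
    ⟨(I K).zero_mem, by rw [map_zero]; exact (I K).zero_mem⟩
    (fun ha hb => ⟨(I K).add_mem ha.1 hb.1, by rw [map_add]; exact (I K).add_mem ha.2 hb.2⟩)
    (fun ha => ⟨(I K).neg_mem ha.1, by rw [map_neg]; exact (I K).neg_mem ha.2⟩)
    (fun {a b} hb => ⟨(I K).mul_mem_left _ _ hb.1, by
      rw [(D K).leibniz]
      exact (I K).add_mem ((I K).mul_mem_left _ _ hb.1) ((I K).mul_mem_left _ _ hb.2)⟩)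
    (fun {a b} ha => ⟨(I K).mul_mem_right _ _ ha.1, by
      rw [(D K).leibniz]
      exact (I K).add_mem ((I K).mul_mem_right _ _ ha.2) ((I K).mul_mem_right _ _ ha.1)⟩)
  have hJ : ∀ a, a ∈ J ↔ a ∈ I K ∧ D K a ∈ I K := fun a => TwoSidedIdeal.mem_mk' _ _ _ _ _ _ _
  have hIk : ∀ k : {k : ℕ // 0 < k}, Ik K k ≤ I K := fun k =>
    le_iSup (fun k : {k : ℕ // 0 < k} => Ik K k) k
  have hle : I K ≤ J := iSup_le fun k => TwoSidedIdeal.span_le.2 fun a ha =>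
    (hJ a).2 ⟨hIk k (TwoSidedIdeal.subset_span ha),
      hIk k (TwoSidedIdeal.subset_span (D_mem_span K ha))⟩
  exact fun a ha => ((hJ a).1 (hle ha)).2

/-- The ring `R = A / I`. -/
abbrev R : Type _ := (I K).ringCon.Quotient

/-- The derivation of `R = A / I` induced by `D`. -/
noncomputable def DR : RingDerivation (R K) := (D K).quotient (I K) (D_mem_I K)

/-- The element `x₀ X` of `R[X; D]`. -/
noncomputable def x0X : DiffPoly (DR K) := DiffPoly.monomial (DR K) 1 ((x K 0 : A K) : R K)

end Shestakov

/-! Local nilpotency is direct: finitely many elements of `R` involve finitely many letters, and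
every sufficiently long word in those letters has a generator of some `I_k` as a prefix.

For the other half, represent `A[X; D]` by infinite upper triangular matrices over a commutative
ring: `X` is the diagonal matrix with entries `u l`, and `x₀` is the shift with entry 1 at each `(s,
s + 1)`. As `D` is the commutator with `X`, the letter `xᵢ` has entry `(u s - u (s + 1)) ^ i` at
`(s, s + 1)`; `eval` and `evalPoly` are the entries `(s, n)`. If `x₀X` had a quasi-inverse `y`, then
`1 + y` would be the geometric series in `-x₀X`, whose entry `(0, n)` is, up to sign, `u 1 ⋯ u n`.
But a lift of `y` has finitely many terms, so its row 0 vanishes far out.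

The relation for `y` only holds modulo `I`, so the `u l` must be chosen with `u 1 ⋯ u n` outside the
entries of `I`. Each `node` is a polynomial with one variable for every triadic interval that is the
middle third of its parent and contains `l`. A variable occurs in `u l - u (l + 1)` only at the two
ends of its interval, so words in small letters have small degree in it, whatever its level. Hence
entries of `I` are `deficient` (`I_le_deficientIdeal`). In the product of the nodes, intervals of
level `i` collect degree at least `i + 1` in a monomial with coefficient one
(`prod_node_notMem_deficient`). -/

namespace Shestakov

/-! ### Matrix entries of `A` and `A[X; D]` -/

section Evaluation

variable {K : Type*} [Field K] {M : Type*} [CommRing M] [Algebra K M]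

/-- The product `∏ₗ (u_{s+l} - u_{s+l+1}) ^ iₗ` over the letters `i₀, i₁, …` of a word. -/
def evalWord (u : ℕ → M) : ℕ → List ℕ → M
  | _, [] => 1
  | s, i :: l => (u s - u (s + 1)) ^ i * evalWord u (s + 1) l

theorem evalWord_append (u : ℕ → M) (s : ℕ) (v w : List ℕ) :
    evalWord u s (v ++ w) = evalWord u s v * evalWord u (s + v.length) w := by
  induction v generalizing s with
  | nil => simp [evalWord]
  | cons i v ih =>
    rw [List.cons_append, evalWord, ih, evalWord, List.length_cons, mul_assoc,
      show s + 1 + v.length = s + (v.length + 1) by omega]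

/-- The list of letters of a nonempty word. -/
def letters (w : FreeSemigroup ℕ) : List ℕ := w.head :: w.tail

theorem letters_mul (v w : FreeSemigroup ℕ) : letters (v * w) = letters v ++ letters w := rfl

theorem length_letters (w : FreeSemigroup ℕ) : (letters w).length = w.length := rfl

variable (K) in
/-- The linear map that sends a word of length `n - s` to its value `evalWord u s`, and all other
words to zero. -/
noncomputable def eval (u : ℕ → M) (s n : ℕ) : A K →ₗ[K] M :=
  Finsupp.linearCombination K
    (fun w : FreeSemigroup ℕ => if s + w.length = n then evalWord u s (letters w) else 0) ∘ₗ
    (MonoidAlgebra.coeffLinearEquiv K).toLinearMap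

theorem eval_mon (u : ℕ → M) (s n : ℕ) (w : FreeSemigroup ℕ) :
    eval K u s n (mon K w) = if s + w.length = n then evalWord u s (letters w) else 0 := by
  simp [eval, mon]

theorem mon_induction {p : A K → Prop} (h0 : p 0) (hadd : ∀ a b, p a → p b → p (a + b))
    (hsmul : ∀ (c : K) (w : FreeSemigroup ℕ), p (c • mon K w)) (a : A K) : p a := by
  induction a using MonoidAlgebra.induction_linear with
  | zero => exact h0
  | add a b ha hb => exact hadd a b ha hb
  | single w c => rw [single_eq]; exact hsmul c w

theorem eval_mon_mul (u : ℕ → M) (s n : ℕ) (w : FreeSemigroup ℕ) (b : A K) :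
    eval K u s n (mon K w * b) = evalWord u s (letters w) * eval K u (s + w.length) n b := by
  induction b using mon_induction with
  | h0 => simp
  | hadd a b ha hb => rw [mul_add, map_add, ha, hb, map_add, mul_add]
  | hsmul c v =>
    rw [mul_smul_comm, map_smul, map_smul, ← mon_mul, eval_mon, eval_mon, letters_mul,
      FreeSemigroup.length_mul, evalWord_append, length_letters, ← add_assoc, mul_smul_comm,
      mul_ite, mul_zero]

theorem eval_mul_mon (u : ℕ → M) (s n : ℕ) (w : FreeSemigroup ℕ) (b : A K) :
    eval K u s (n + w.length) (b * mon K w) = eval K u s n b * evalWord u n (letters w) := by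
  induction b using mon_induction with
  | h0 => simp
  | hadd a b ha hb => rw [add_mul, map_add, ha, hb, map_add, add_mul]
  | hsmul c v =>
    rw [smul_mul_assoc, map_smul, map_smul, ← mon_mul, eval_mon, eval_mon, letters_mul,
      FreeSemigroup.length_mul, evalWord_append, length_letters, ← add_assoc, smul_mul_assoc,
      ite_mul, zero_mul]
    by_cases h : s + v.length = n
    · simp [h]
    · simp [h]

theorem eval_mul_mon_of_lt (u : ℕ → M) {s n : ℕ} (w : FreeSemigroup ℕ) (h : n < w.length)
    (b : A K) : eval K u s n (b * mon K w) = 0 := by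
  induction b using mon_induction with
  | h0 => simp
  | hadd a b ha hb => rw [add_mul, map_add, ha, hb, add_zero]
  | hsmul c v =>
    rw [smul_mul_assoc, map_smul, ← mon_mul, eval_mon, FreeSemigroup.length_mul,
      if_neg (by omega), smul_zero]

theorem eval_x_mul (u : ℕ → M) (s n i : ℕ) (b : A K) :
    eval K u s n (x K i * b) = (u s - u (s + 1)) ^ i * eval K u (s + 1) n b := by
  rw [x, eval_mon_mul]
  simp [letters, evalWord, FreeSemigroup.of, FreeSemigroup.length]

theorem eval_self (u : ℕ → M) (s : ℕ) (b : A K) : eval K u s s b = 0 := by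
  induction b using mon_induction with
  | h0 => simp
  | hadd a b ha hb => rw [map_add, ha, hb, add_zero]
  | hsmul c v =>
    rw [map_smul, eval_mon, if_neg (by have : v.length = v.tail.length + 1 := rfl; omega),
      smul_zero]

/-- Raising the index of the letter at position `l` multiplies the value by `u l - u (l + 1)`; the
Leibniz sum telescopes. Equivalently, `D` is the commutator with the diagonal matrix `u`. -/
theorem eval_derivWord (u : ℕ → M) (s n i : ℕ) (l : List ℕ) :
    eval K u s n (derivWord K i l) = (u s - u n) * eval K u s n (mon K ⟨i, l⟩) := by
  induction l generalizing s i with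
  | nil =>
    rw [derivWord, x, eval_mon, eval_mon]
    by_cases h : s + 1 = n
    · subst h
      simp [letters, evalWord, FreeSemigroup.of, FreeSemigroup.length, pow_succ']
    · simp [FreeSemigroup.of, FreeSemigroup.length, h]
  | cons j l ih =>
    have h2 : mon K ⟨i, j :: l⟩ = x K i * mon K ⟨j, l⟩ := by
      rw [x, ← mon_mul]; rfl
    rw [derivWord, map_add, eval_x_mul, eval_x_mul, ih, h2, eval_x_mul]
    ring

theorem eval_D (u : ℕ → M) (s n : ℕ) (b : A K) :
    eval K u s n (D K b) = (u s - u n) * eval K u s n b := by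
  change eval K u s n (derivLin K b) = _
  induction b using mon_induction with
  | h0 => simp
  | hadd a b ha hb => rw [map_add, map_add, ha, hb, map_add, mul_add]
  | hsmul c w =>
    rw [map_smul, map_smul, map_smul, derivLin_mon, eval_derivWord, mul_smul_comm]

theorem eval_eventually_zero (u : ℕ → M) (b : A K) :
    ∃ N, ∀ n, N ≤ n → eval K u 0 n b = 0 := by
  induction b using mon_induction with
  | h0 => exact ⟨0, by simp⟩
  | hadd a b ha hb =>
    obtain ⟨N, hN⟩ := ha
    obtain ⟨N', hN'⟩ := hb
    exact ⟨max N N', fun n hn => by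
      rw [map_add, hN n (le_trans (le_max_left _ _) hn), hN' n (le_trans (le_max_right _ _) hn),
        add_zero]⟩
  | hsmul c w =>
    exact ⟨w.length + 1, fun n hn => by
      rw [map_smul, eval_mon, if_neg (by omega), smul_zero]⟩

theorem evalWord_mem (S : Subalgebra K M) (u : ℕ → M) (s : ℕ) (l : List ℕ)
    (h : ∀ i, s ≤ i → i ≤ s + l.length → u i ∈ S) : evalWord u s l ∈ S := by
  induction l generalizing s with
  | nil => exact S.one_mem
  | cons i l ih =>
    rw [List.length_cons] at h
    exact S.mul_mem (S.pow_mem (S.sub_mem (h _ le_rfl (by omega)) (h _ (by omega) (by omega))) _)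
      (ih _ fun j h1 h2 => h j (by omega) (by omega))

/-- The map `A[X; D] → M` that extends `eval` by sending `X` to the right of a word to `uₙ`. -/
noncomputable def evalPoly (u : ℕ → M) (s n : ℕ) : DiffPoly (D K) →+ M :=
  DiffPoly.liftAdd fun j => (AddMonoidHom.mulRight (u n ^ j)).comp (eval K u s n).toAddMonoidHom

theorem evalPoly_monomial (u : ℕ → M) (s n j : ℕ) (b : A K) :
    evalPoly u s n (DiffPoly.monomial (D K) j b) = eval K u s n b * u n ^ j :=
  DiffPoly.liftAdd_monomial _ _ _

/-- From `X b = b X + D(b)` the factor is `u n + (u s - u n) = u s`. -/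
theorem evalPoly_mulX (u : ℕ → M) (s n : ℕ) (p : DiffPoly (D K)) :
    evalPoly u s n (DiffPoly.mulX (D K) p) = u s * evalPoly u s n p := by
  have : (evalPoly u s n).comp (DiffPoly.mulX (D K))
      = (AddMonoidHom.mulLeft (u s)).comp (evalPoly u s n) := DiffPoly.addHom_ext fun j b => by
    simp only [AddMonoidHom.comp_apply, DiffPoly.mulX_monomial, map_add, evalPoly_monomial,
      eval_D, AddMonoidHom.coe_mulLeft]
    ring
  exact DFunLike.congr_fun this p

theorem evalPoly_mulC_x (u : ℕ → M) (s n : ℕ) (p : DiffPoly (D K)) :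
    evalPoly u s n (DiffPoly.mulC (D K) (x K 0) p) = evalPoly u (s + 1) n p := by
  have : (evalPoly u s n).comp (DiffPoly.mulC (D K) (x K 0)) = evalPoly u (s + 1) n :=
    DiffPoly.addHom_ext fun j b => by
      rw [AddMonoidHom.comp_apply, DiffPoly.mulC_monomial, evalPoly_monomial, evalPoly_monomial,
        eval_x_mul, pow_zero, one_mul]
  exact DFunLike.congr_fun this p

theorem evalPoly_self (u : ℕ → M) (s : ℕ) (p : DiffPoly (D K)) : evalPoly u s s p = 0 := by
  have : evalPoly u s s = (0 : DiffPoly (D K) →+ M) := DiffPoly.addHom_ext fun j b => by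
    rw [evalPoly_monomial, eval_self, zero_mul, AddMonoidHom.zero_apply]
  exact DFunLike.congr_fun this p

theorem evalPoly_eq_sum (u : ℕ → M) (s n : ℕ) (p : DiffPoly (D K)) :
    evalPoly u s n p = p.coeff.sum fun j b => eval K u s n b * u n ^ j := by
  simp only [evalPoly, DiffPoly.liftAdd, AddMonoidHom.coe_mk, ZeroHom.coe_mk,
    Finsupp.liftAddHom_apply]
  rfl

theorem evalPoly_eventually_zero (u : ℕ → M) (p : DiffPoly (D K)) :
    ∃ N, ∀ n, N ≤ n → evalPoly u 0 n p = 0 := by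
  choose N hN using fun j => eval_eventually_zero u (p.coeff j)
  refine ⟨p.coeff.support.sup N, fun n hn => ?_⟩
  rw [evalPoly_eq_sum]
  refine Finset.sum_eq_zero fun j hj => ?_
  simp only [hN j n (le_trans (Finset.le_sup hj) hn), zero_mul]

end Evaluation


/-! ### Triadic nodes and deficient polynomials -/

section Nodes

variable (K : Type*) [Field K]

open MvPolynomial

/-- The value of `X` at the position `l`: one plus the sum of the variables indexed by the triadic
intervals `[j 3ⁱ, (j + 1) 3ⁱ)`, `j ≡ 1` modulo `3`, that contain `l`. -/
noncomputable def node (l : ℕ) : MvPolynomial (ℕ × ℕ) K :=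
  1 + ∑ i ∈ (Finset.range l).filter (fun i => l / 3 ^ i % 3 = 1), X (i, l / 3 ^ i)

/-- The triadic interval `[j 3ⁱ, (j + 1) 3ⁱ)` has `j ≡ 1` modulo `3` and lies strictly
between `s` and `n`. -/
def Inside (s n : ℕ) (r : ℕ × ℕ) : Prop :=
  r.2 % 3 = 1 ∧ s < r.2 * 3 ^ r.1 ∧ (r.2 + 1) * 3 ^ r.1 ≤ n

theorem Inside.mono {s s' n n' : ℕ} {r : ℕ × ℕ} (h : Inside s' n' r) (hs : s ≤ s')
    (hn : n' ≤ n) : Inside s n r :=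
  ⟨h.1, hs.trans_lt h.2.1, h.2.2.trans hn⟩

theorem div_pow_eq_iff {l i j : ℕ} : l / 3 ^ i = j ↔ j * 3 ^ i ≤ l ∧ l < (j + 1) * 3 ^ i :=
  ⟨fun h => h ▸ ⟨Nat.div_mul_le_self _ _, Nat.lt_mul_of_div_lt (Nat.lt_succ_self _)
    (by positivity)⟩, fun h => Nat.div_eq_of_lt_le h.1 h.2⟩

/-- The polynomials in which no monomial has degree at least `i + 1` in each of the variables
`(i, j)` inside the interval from `s` to `n`. -/
noncomputable def deficient (s n : ℕ) : Submodule K (MvPolynomial (ℕ × ℕ) K) where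
  carrier := {p | ∀ m : ℕ × ℕ →₀ ℕ, (∀ r, Inside s n r → r.1 + 1 ≤ m r) → coeff m p = 0}
  add_mem' hp hq m hm := by rw [coeff_add, hp m hm, hq m hm, add_zero]
  zero_mem' m _ := coeff_zero m
  smul_mem' c p hp m hm := by rw [coeff_smul, hp m hm, smul_zero]

/-- The polynomials in the variables that do not lie inside the interval from `s` to `n`. -/
noncomputable abbrev outer (s n : ℕ) : Subalgebra K (MvPolynomial (ℕ × ℕ) K) :=
  supported K {r | ¬ Inside s n r}

variable {K}

theorem deficient_mono {s s' n n' : ℕ} (hs : s ≤ s') (hn : n' ≤ n) :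
    deficient K s' n' ≤ deficient K s n :=
  fun _ hp m hm => hp m fun r hr => hm r (hr.mono hs hn)

/-- The factor `q` has no inside variable, so the inside exponents of a monomial of `q * p` all come
from `p`. -/
theorem mul_mem_deficient {s n : ℕ} {p q : MvPolynomial (ℕ × ℕ) K} (hq : q ∈ outer K s n)
    (hp : p ∈ deficient K s n) : q * p ∈ deficient K s n := by
  intro m hm
  rw [coeff_mul]
  refine Finset.sum_eq_zero fun ab hab => ?_
  rw [Finset.HasAntidiagonal.mem_antidiagonal] at hab
  by_cases ha : coeff ab.1 q = 0
  · rw [ha, zero_mul]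
  rw [hp ab.2 fun r hr => ?_, mul_zero]
  have h0 : ab.1 r = 0 := by
    by_contra h
    exact mem_supported.1 hq ((mem_vars_iff_mem_support r).2
      ⟨ab.1, mem_support_iff.2 ha, Finsupp.mem_support_iff.2 h⟩) hr
  have := hm r hr
  rw [← hab, Finsupp.add_apply, h0, zero_add] at this
  exact this

theorem node_mem_outer {s n l : ℕ} (h : l ≤ s ∨ n ≤ l) : node K l ∈ outer K s n := by
  refine add_mem (one_mem _) (sum_mem fun i _ => X_mem_supported.2 fun hi => ?_)
  have h1 := (div_pow_eq_iff (l := l) (i := i)).1 rfl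
  have h2 := hi.2.1
  have h3 := hi.2.2
  dsimp only at h2 h3
  omega

/-- Isolates the variable `r`, so that it visibly cancels between two nodes on the same side of both
ends of its interval. -/
theorem node_eq {r : ℕ × ℕ} (hr : r.2 % 3 = 1) (l : ℕ) :
    ∃ q ∈ supported K {r}ᶜ, node K l = (if l / 3 ^ r.1 = r.2 then X r else 0) + q := by
  obtain ⟨i, j⟩ := r
  dsimp only at hr ⊢
  split_ifs with h
  · have hi : i ∈ (Finset.range l).filter (fun i => l / 3 ^ i % 3 = 1) := by
      have h1 := div_pow_eq_iff.1 h
      have h2 : i < 3 ^ i := Nat.lt_pow_self (by norm_num)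
      have h3 : 1 * 3 ^ i ≤ j * 3 ^ i := Nat.mul_le_mul_right _ (by omega)
      rw [Finset.mem_filter, Finset.mem_range, h]
      exact ⟨by omega, hr⟩
    refine ⟨_, ?_, by rw [node, ← Finset.add_sum_erase _ _ hi, h]; exact add_left_comm _ _ _⟩
    refine add_mem (one_mem _) (sum_mem fun i' hi' => X_mem_supported.2 fun he => ?_)
    exact (Finset.mem_erase.1 hi').1 (congrArg Prod.fst he)
  · refine ⟨node K l, ?_, (zero_add _).symm⟩
    refine add_mem (one_mem _) (sum_mem fun i' _ => X_mem_supported.2 fun he => h ?_)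
    have he1 : i' = i := congrArg Prod.fst he
    have he2 : l / 3 ^ i' = j := congrArg Prod.snd he
    rw [← he1, he2]

theorem degreeOf_eq_zero_of_mem_supported {r : ℕ × ℕ} {q : MvPolynomial (ℕ × ℕ) K}
    (hq : q ∈ supported K {r}ᶜ) : degreeOf r q = 0 := by
  by_contra h
  exact mem_supported.1 hq (mem_vars_iff_degreeOf_ne_zero.2 h) rfl

theorem degreeOf_node_le {r : ℕ × ℕ} (hr : r.2 % 3 = 1) (l : ℕ) : degreeOf r (node K l) ≤ 1 := by
  obtain ⟨q, hq, h⟩ := node_eq (K := K) hr l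
  rw [h]
  refine (degreeOf_add_le _ _ _).trans (max_le ?_ ?_)
  · split_ifs
    · exact (degreeOf_X_self (R := K) r).le
    · simp
  · rw [degreeOf_eq_zero_of_mem_supported hq]; exact zero_le_one

/-- The variable indexed by an interval occurs in the difference of two consecutive nodes only
at the two ends of the interval. -/
theorem degreeOf_node_sub_le {r : ℕ × ℕ} (hr : r.2 % 3 = 1) (l : ℕ) :
    degreeOf r (node K l - node K (l + 1)) ≤
      if l + 1 = r.2 * 3 ^ r.1 ∨ l + 1 = (r.2 + 1) * 3 ^ r.1 then 1 else 0 := by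
  split_ifs with hl
  · exact (degreeOf_sub_le _ _ _).trans
      (max_le (degreeOf_node_le hr l) (degreeOf_node_le hr (l + 1)))
  · obtain ⟨q, hq, h⟩ := node_eq (K := K) hr l
    obtain ⟨q', hq', h'⟩ := node_eq (K := K) hr (l + 1)
    have hiff : l / 3 ^ r.1 = r.2 ↔ (l + 1) / 3 ^ r.1 = r.2 := by
      rw [div_pow_eq_iff, div_pow_eq_iff]; omega
    rw [h, h', if_congr hiff rfl rfl, add_sub_add_left_eq_sub,
      degreeOf_eq_zero_of_mem_supported (sub_mem hq hq')]

theorem degreeOf_evalWord_le {r : ℕ × ℕ} (hr : r.2 % 3 = 1) {k : ℕ} (s : ℕ) (w : List ℕ)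
    (hw : ∀ i ∈ w, i ≤ k) : degreeOf r (evalWord (node K) s w) ≤
      k * ((Finset.Ico s (s + w.length)).filter
        fun l => l + 1 = r.2 * 3 ^ r.1 ∨ l + 1 = (r.2 + 1) * 3 ^ r.1).card := by
  induction w generalizing s with
  | nil => simp [evalWord]
  | cons i w ih =>
    have e : Finset.Ico s (s + (i :: w).length) =
        insert s (Finset.Ico (s + 1) (s + 1 + w.length)) := by
      ext a; simp only [List.length_cons, Finset.mem_Ico, Finset.mem_insert]; omega
    rw [evalWord, e, Finset.filter_insert]
    refine (degreeOf_mul_le _ _ _).trans ((Nat.add_le_add ((degreeOf_pow_le _ _ _).trans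
      (Nat.mul_le_mul (hw i (by simp)) (degreeOf_node_sub_le hr s)))
      (ih (s + 1) fun a ha => hw a (by simp [ha]))).trans ?_)
    split_ifs
    · rw [Finset.card_insert_of_notMem (by simp)]
      exact le_of_eq (by ring)
    · simp

theorem degreeOf_evalWord_le_two_mul {r : ℕ × ℕ} (hr : r.2 % 3 = 1) {k : ℕ} (s : ℕ) (w : List ℕ)
    (hw : ∀ i ∈ w, i ≤ k) : degreeOf r (evalWord (node K) s w) ≤ 2 * k := by
  refine (degreeOf_evalWord_le hr s w hw).trans ?_
  rw [mul_comm]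
  refine Nat.mul_le_mul_right _ (le_trans (Finset.card_le_card ?_)
    (Finset.card_le_two (a := r.2 * 3 ^ r.1 - 1) (b := (r.2 + 1) * 3 ^ r.1 - 1)))
  intro l hl
  simp only [Finset.mem_filter, Finset.mem_insert, Finset.mem_singleton] at hl ⊢
  omega

theorem exists_inside {s n i : ℕ} (h : s + 2 * 3 ^ (i + 1) ≤ n) : ∃ j, Inside s n (i, j) := by
  have h1 := Nat.div_mul_le_self s (3 ^ (i + 1))
  have h2 := Nat.lt_mul_of_div_lt (Nat.lt_succ_self (s / 3 ^ (i + 1)))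
    (show 0 < 3 ^ (i + 1) by positivity)
  -- The middle third of the first triadic interval of length `3 ^ (i + 1)` that starts after `s`.
  refine ⟨(s / 3 ^ (i + 1) + 1) * 3 + 1, by dsimp only; omega, ?_, ?_⟩
  all_goals
    dsimp only
    generalize s / 3 ^ (i + 1) = c at *
    rw [pow_succ] at *
    nlinarith [show 0 < 3 ^ i by positivity]

/-- The two ends of an interval contribute degree at most `k` each, whereas a variable of level `2 *
k` is required to have degree at least `2 * k + 1`. -/
theorem evalWord_mem_deficient {k s n : ℕ} (w : List ℕ) (hw : ∀ i ∈ w, i ≤ k)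
    (hn : s + 2 * 3 ^ (2 * k + 1) ≤ n) : evalWord (node K) s w ∈ deficient K s n := by
  obtain ⟨j, hj⟩ := exists_inside hn
  intro m hm
  by_contra h
  have h1 := monomial_le_degreeOf (2 * k, j) (mem_support_iff.2 h)
  have h2 := degreeOf_evalWord_le_two_mul (K := K) hj.1 s w hw
  have h3 := hm _ hj
  dsimp only at h3
  omega

end Nodes
-- Leading monomials of products of nodes
section Leading
open MvPolynomial

variable {K : Type*} [Field K] {σ : Type*}

/-- The polynomial `p` has leading monomial `m`, with coefficient one, for the weight `w`. -/
def HasLeading (w : σ → ℚ) (p : MvPolynomial σ K) (m : σ →₀ ℕ) : Prop :=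
  coeff m p = 1 ∧ ∀ m', coeff m' p ≠ 0 → m' = m ∨ Finsupp.weight w m' < Finsupp.weight w m

/-- Different monomials may share a weight, but here each leading monomial is the only one of
maximal weight, so just the pair `(a, b)` reaches the top weight and nothing cancels. -/
theorem HasLeading.mul {w : σ → ℚ} {p q : MvPolynomial σ K} {a b : σ →₀ ℕ}
    (hp : HasLeading w p a) (hq : HasLeading w q b) : HasLeading w (p * q) (a + b) := by
  classical
  constructor
  · rw [coeff_mul, Finset.sum_eq_single (a, b), hp.1, hq.1, one_mul]
    · rintro ⟨a', b'⟩ hab hne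
      rw [Finset.HasAntidiagonal.mem_antidiagonal] at hab
      dsimp only at hab ⊢
      by_contra h
      have hw := congrArg (Finsupp.weight w) hab
      rw [map_add, map_add] at hw
      rcases hp.2 a' (left_ne_zero_of_mul h) with rfl | ha
      · exact hne (by rw [add_left_cancel hab])
      · rcases hq.2 b' (right_ne_zero_of_mul h) with rfl | hb <;> linarith
    · intro h
      rw [Finset.HasAntidiagonal.mem_antidiagonal] at h
      exact absurd rfl h
  · intro m hm
    rw [coeff_mul] at hm
    obtain ⟨⟨a', b'⟩, hab, h⟩ := Finset.exists_ne_zero_of_sum_ne_zero hm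
    rw [Finset.HasAntidiagonal.mem_antidiagonal] at hab
    dsimp only at hab h
    rw [← hab, map_add, map_add]
    rcases hp.2 a' (left_ne_zero_of_mul h) with rfl | ha <;>
      rcases hq.2 b' (right_ne_zero_of_mul h) with rfl | hb
    · exact Or.inl rfl
    all_goals right; linarith

theorem hasLeading_one (w : σ → ℚ) : HasLeading w (1 : MvPolynomial σ K) 0 := by
  classical
  refine ⟨by simp, fun m hm => ?_⟩
  rw [coeff_one] at hm
  exact Or.inl (by by_contra h; exact hm (if_neg (Ne.symm h)))

theorem HasLeading.prod {ι : Type*} {w : σ → ℚ} {p : ι → MvPolynomial σ K} {m : ι → σ →₀ ℕ}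
    (h : ∀ i, HasLeading w (p i) (m i)) (s : Finset ι) :
    HasLeading w (∏ i ∈ s, p i) (∑ i ∈ s, m i) := by
  classical
  induction s using Finset.induction_on with
  | empty => exact hasLeading_one w
  | insert i s hi ih => rw [Finset.prod_insert hi, Finset.sum_insert hi]; exact (h i).mul ih

/-- The sum of one and of variables of different positive weights has as its leading monomial
the variable of the highest weight. -/
theorem hasLeading_one_add_sum [DecidableEq σ] {w : σ → ℚ} {s : Finset ℕ} {f : ℕ → σ}
    (hw : ∀ r, 0 < w r)
    {i : ℕ} (hi : i ∈ s) (hmax : ∀ i' ∈ s, i' ≠ i → w (f i') < w (f i)) :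
    HasLeading w (1 + ∑ i ∈ s, X (f i) : MvPolynomial σ K) (Finsupp.single (f i) 1) := by
  have hc : ∀ m : σ →₀ ℕ, coeff m (1 + ∑ i ∈ s, X (f i) : MvPolynomial σ K)
      = (if 0 = m then 1 else 0) + ∑ i ∈ s, if Finsupp.single (f i) 1 = m then 1 else 0 := by
    intro m
    rw [coeff_add, coeff_one, coeff_sum]
    simp only [coeff_X]
  constructor
  · rw [hc, if_neg (by simp [eq_comm]), zero_add, Finset.sum_eq_single_of_mem i hi, if_pos rfl]
    intro i' hi' hne
    rw [if_neg]
    intro h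
    have := hmax i' hi' hne
    rw [Finsupp.single_left_injective one_ne_zero h] at this
    exact lt_irrefl _ this
  · intro m hm
    rw [hc] at hm
    by_cases h0 : 0 = m
    · right
      rw [← h0, map_zero, Finsupp.weight_single, one_smul]
      exact hw _
    rw [if_neg h0, zero_add] at hm
    obtain ⟨i', hi', h⟩ := Finset.exists_ne_zero_of_sum_ne_zero hm
    have h : Finsupp.single (f i') 1 = m := by
      by_contra h'; exact h (if_neg h')
    by_cases he : i' = i
    · left; rw [← h, he]
    · right
      rw [← h, Finsupp.weight_single, Finsupp.weight_single, one_smul, one_smul]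
      exact hmax i' hi' he

open Classical in
/-- The leading monomial of `node K l`. -/
noncomputable def lead (l : ℕ) : ℕ × ℕ →₀ ℕ :=
  if h : ∃ i, l / 3 ^ i % 3 = 1 then Finsupp.single (Nat.find h, l / 3 ^ Nat.find h) 1 else 0

theorem lt_of_div_pow_mod {l i : ℕ} (h : l / 3 ^ i % 3 = 1) : i < l := by
  by_contra hi
  rw [Nat.div_eq_of_lt ((not_lt.1 hi).trans_lt (Nat.lt_pow_self (by norm_num)))] at h
  simp at h

/-- The weight `(1 / 2) ^ i` falls with the level, so the smallest interval wins. If no ternary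
digit of `l` is 1, only the constant 1 in `node` is left, and it leads. -/
theorem node_hasLeading (l : ℕ) :
    HasLeading (fun r : ℕ × ℕ => (1 / 2 : ℚ) ^ r.1) (node K l) (lead l) := by
  classical
  unfold lead
  split_ifs with h
  · refine hasLeading_one_add_sum (f := fun i => (i, l / 3 ^ i)) (fun r => by positivity)
      (i := Nat.find h) ?_ fun i' hi' hne => ?_
    · exact Finset.mem_filter.2
        ⟨Finset.mem_range.2 (lt_of_div_pow_mod (Nat.find_spec h)), Nat.find_spec h⟩
    · have := Nat.find_min' h (Finset.mem_filter.1 hi').2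
      exact pow_lt_pow_right_of_lt_one₀ (by norm_num) (by norm_num)
        (lt_of_le_of_ne this (Ne.symm hne))
  · rw [node, Finset.filter_false_of_mem fun i _ hi => h ⟨i, hi⟩, Finset.sum_empty, add_zero]
    exact hasLeading_one _

/-- The ternary digits below place `i` are those of `x`, and the digit at place `i` is `j % 3`; so
`i` is the first place with digit 1. -/
theorem lead_eq_single {i j x : ℕ} (hj : j % 3 = 1) (hx : x < 3 ^ i)
    (hd : ∀ i' < i, x / 3 ^ i' % 3 ≠ 1) : lead (j * 3 ^ i + x) = Finsupp.single (i, j) 1 := by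
  classical
  have hdiv : (j * 3 ^ i + x) / 3 ^ i = j := div_pow_eq_iff.2 ⟨by omega, by rw [add_mul]; omega⟩
  have h : ∃ i', (j * 3 ^ i + x) / 3 ^ i' % 3 = 1 := ⟨i, by rw [hdiv, hj]⟩
  have hf : Nat.find h = i := by
    rw [Nat.find_eq_iff]
    refine ⟨by rw [hdiv, hj], fun i' hi' he => hd i' hi' ?_⟩
    obtain ⟨c, rfl⟩ : ∃ c, i = i' + (c + 1) := ⟨i - i' - 1, by omega⟩
    rw [show j * 3 ^ (i' + (c + 1)) + x = x + 3 ^ i' * (3 * (j * 3 ^ c)) by ring,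
      Nat.add_mul_div_left _ _ (by positivity), Nat.add_mul_mod_self_left] at he
    exact he
  rw [lead, dif_pos h, hf, hdiv]

theorem two_mul_pow_div_mod (a i : ℕ) : 2 * 3 ^ a / 3 ^ i % 3 ≠ 1 := by
  rcases lt_trichotomy i a with h | rfl | h
  · obtain ⟨c, rfl⟩ : ∃ c, a = i + (c + 1) := ⟨a - i - 1, by omega⟩
    rw [show 2 * 3 ^ (i + (c + 1)) = 3 ^ i * (3 * (2 * 3 ^ c)) by ring,
      Nat.mul_div_cancel_left _ (by positivity)]
    omega
  · rw [Nat.mul_div_cancel _ (by positivity)]; norm_num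
  · rw [Nat.div_eq_of_lt]
    · norm_num
    · calc 2 * 3 ^ a < 3 ^ (a + 1) := by rw [pow_succ]; have : 0 < 3 ^ a := by positivity
                                         omega
        _ ≤ 3 ^ i := Nat.pow_le_pow_right (by norm_num) h

theorem le_sum_lead {n : ℕ} {r : ℕ × ℕ} (hr : Inside 0 n r) :
    r.1 + 1 ≤ (∑ l ∈ Finset.Ioc 0 n, lead l) r := by
  classical
  obtain ⟨i, j⟩ := r
  obtain ⟨hj, h0, hn⟩ := hr
  dsimp only at hj h0 hn ⊢
  -- The offsets `0, 2, 2 * 3, …, 2 * 3 ^ (i - 1)` have no ternary digit 1. They give `i + 1` points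
  -- of the interval whose node is led by its variable.
  let g : ℕ → ℕ := fun a => if a = 0 then 0 else 2 * 3 ^ (a - 1)
  have hmono : StrictMono g := strictMono_nat_of_lt_succ fun a => by
    rcases a with _ | a
    · simp [g]
    · simp only [g, Nat.add_sub_cancel, if_neg (Nat.succ_ne_zero _)]
      have : 3 ^ a < 3 ^ (a + 1) := Nat.pow_lt_pow_right (by norm_num) (Nat.lt_succ_self a)
      omega
  have hlt : ∀ a ≤ i, g a < 3 ^ i := fun a ha => by
    rcases a with _ | a
    · simp only [g, if_true]; positivity
    · simp only [g, Nat.add_sub_cancel, if_neg (Nat.succ_ne_zero _)]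
      calc 2 * 3 ^ a < 3 ^ (a + 1) := by
            rw [pow_succ]; have : 0 < 3 ^ a := by positivity
            omega
        _ ≤ 3 ^ i := Nat.pow_le_pow_right (by norm_num) ha
  have hlead : ∀ a ≤ i, lead (j * 3 ^ i + g a) = Finsupp.single (i, j) 1 := fun a ha =>
    lead_eq_single hj (hlt a ha) fun i' _ => by
      rcases a with _ | a
      · simp [g]
      · exact two_mul_pow_div_mod a i'
  rw [Finsupp.finsetSum_apply]
  calc i + 1 = ∑ l ∈ (Finset.range (i + 1)).image (fun a => j * 3 ^ i + g a), lead l (i, j) := by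
        rw [Finset.sum_image fun a _ b _ h => hmono.injective (Nat.add_left_cancel h),
          Finset.sum_congr rfl fun a ha => by
            rw [hlead a (Nat.lt_succ_iff.1 (Finset.mem_range.1 ha)), Finsupp.single_eq_same]]
        simp
    _ ≤ _ := Finset.sum_le_sum_of_subset fun l hl => by
        obtain ⟨a, ha, rfl⟩ := Finset.mem_image.1 hl
        have := hlt a (Nat.lt_succ_iff.1 (Finset.mem_range.1 ha))
        rw [add_mul] at hn
        exact Finset.mem_Ioc.2 ⟨by omega, by omega⟩

theorem prod_node_notMem_deficient (n : ℕ) :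
    ∏ l ∈ Finset.Ioc 0 n, node K l ∉ deficient K 0 n := fun h => by
  have h0 := h _ fun r hr => le_sum_lead hr
  rw [(HasLeading.prod node_hasLeading _).1] at h0
  exact one_ne_zero h0

end Leading

/-! ### Deficiency of the entries of `I` -/

section Ideal

variable (K : Type*) [Field K]

/-- The elements of `A` all whose values at the nodes are deficient. -/
noncomputable def deficientIdeal : TwoSidedIdeal (A K) :=
  TwoSidedIdeal.mk' {a | ∀ s n, eval K (node K) s n a ∈ deficient K s n}
    (fun s _ => by rw [map_zero]; exact zero_mem _)
    (fun ha hb s n => by rw [map_add]; exact add_mem (ha s n) (hb s n))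
    (fun ha s n => by rw [map_neg]; exact neg_mem (ha s n))
    (fun {a b} hb s n => by
      induction a using mon_induction with
      | h0 => rw [zero_mul, map_zero]; exact zero_mem _
      | hadd a a' ha ha' => rw [add_mul, map_add]; exact add_mem ha ha'
      | hsmul c w =>
        rw [smul_mul_assoc, map_smul, eval_mon_mul]
        -- The left factor involves only nodes up to the start of the remaining interval, which are
        -- outer for it.
        exact Submodule.smul_mem _ _ (deficient_mono (Nat.le_add_right _ _) le_rfl
          (mul_mem_deficient (evalWord_mem _ _ _ _ fun _ _ h => node_mem_outer (Or.inl h))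
            (hb _ _))))
    (fun {a b} ha s n => by
      induction b using mon_induction with
      | h0 => rw [mul_zero, map_zero]; exact zero_mem _
      | hadd b b' hb hb' => rw [mul_add, map_add]; exact add_mem hb hb'
      | hsmul c w =>
        rw [mul_smul_comm, map_smul]
        refine Submodule.smul_mem _ _ ?_
        rcases lt_or_ge n w.length with h | h
        · rw [eval_mul_mon_of_lt _ _ h]; exact zero_mem _
        · obtain ⟨n, rfl⟩ := Nat.exists_eq_add_of_le' h
          rw [eval_mul_mon, mul_comm]
          exact deficient_mono le_rfl (Nat.le_add_right _ _)
            (mul_mem_deficient (evalWord_mem _ _ _ _ fun i h _ => node_mem_outer (Or.inr h))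
              (ha _ _)))

theorem mem_deficientIdeal {a : A K} :
    a ∈ deficientIdeal K ↔ ∀ s n, eval K (node K) s n a ∈ deficient K s n :=
  TwoSidedIdeal.mem_mk' _ _ _ _ _ _ _

/-- Letters below `k` are at most `k - 1`, whence the exponent on the left. -/
theorem mul_three_pow_le {k : ℕ} (hk : 0 < k) :
    2 * 3 ^ (2 * (k - 1) + 1) ≤ 2 * 100 ^ k ^ 2 := by
  have h1 : (3 : ℕ) ^ (2 * (k - 1) + 1) ≤ 3 ^ (2 * k) :=
    Nat.pow_le_pow_right (by norm_num) (by omega)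
  have h2 : (3 : ℕ) ^ (2 * k) ≤ 100 ^ k := by
    rw [pow_mul]; exact Nat.pow_le_pow_left (by norm_num) _
  have h3 : (100 : ℕ) ^ k ≤ 100 ^ k ^ 2 :=
    Nat.pow_le_pow_right (by norm_num) (Nat.le_self_pow two_ne_zero k)
  omega

theorem Wstep_subset_deficientIdeal {k : ℕ} (hk : 0 < k) (t : ℕ) :
    ∀ a ∈ Wstep K k (2 * 100 ^ k ^ 2) t, a ∈ deficientIdeal K := by
  induction t with
  | zero =>
    rintro _ ⟨w, hw, hlt, rfl⟩
    refine (mem_deficientIdeal K).2 fun s n => ?_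
    rw [eval_mon]
    split_ifs with h
    · refine evalWord_mem_deficient (k := k - 1) _
        (fun i hi => Nat.le_sub_one_of_lt (hlt i hi)) ?_
      rw [← h, hw]
      exact Nat.add_le_add_left (mul_three_pow_le hk) s
    · exact zero_mem _
  | succ t ih =>
    rintro _ ⟨a, ha, rfl⟩
    refine (mem_deficientIdeal K).2 fun s n => ?_
    rw [eval_D]
    -- `D` multiplies the entry `(s, n)` by a difference of the two end nodes, which is outer.
    exact mul_mem_deficient
      (sub_mem (node_mem_outer (Or.inl le_rfl)) (node_mem_outer (Or.inr le_rfl)))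
      ((mem_deficientIdeal K).1 (ih a ha) s n)

theorem I_le_deficientIdeal : I K ≤ deficientIdeal K := by
  refine iSup_le fun k => TwoSidedIdeal.span_le.2 fun a ha => ?_
  induction ha using Submodule.span_induction with
  | mem a ha =>
    obtain ⟨t, ht⟩ := Set.mem_iUnion.1 ha
    exact Wstep_subset_deficientIdeal K k.2 t a ht
  | zero => exact (deficientIdeal K).zero_mem
  | add a b _ _ ha hb => exact (deficientIdeal K).add_mem ha hb
  | smul c a _ ha =>
    refine (mem_deficientIdeal K).2 fun s n => ?_
    rw [map_smul]
    exact Submodule.smul_mem _ _ ((mem_deficientIdeal K).1 ha s n)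

end Ideal

/-! ### `x₀X` is not quasi-regular -/

section Quotient

variable (K : Type*) [Field K]

/-- The map `A[X; D] → R[X; D]`. -/
noncomputable def polyMk : DiffPoly (D K) →+ DiffPoly (DR K) :=
  DiffPoly.liftAdd fun j => (DiffPoly.monomialHom (DR K) j).comp
    (AddMonoidHom.mk' (fun a : A K => (a : R K)) fun _ _ => rfl)

theorem polyMk_monomial (j : ℕ) (a : A K) :
    polyMk K (DiffPoly.monomial (D K) j a) = DiffPoly.monomial (DR K) j (a : R K) :=
  DiffPoly.liftAdd_monomial _ _ _

theorem polyMk_mulX (p : DiffPoly (D K)) :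
    polyMk K (DiffPoly.mulX (D K) p) = DiffPoly.mulX (DR K) (polyMk K p) := by
  have : (polyMk K).comp (DiffPoly.mulX (D K)) = (DiffPoly.mulX (DR K)).comp (polyMk K) :=
    DiffPoly.addHom_ext fun j b => by
      simp only [AddMonoidHom.comp_apply, DiffPoly.mulX_monomial, map_add, polyMk_monomial]
      rfl
  exact DFunLike.congr_fun this p

theorem polyMk_mulC (a : A K) (p : DiffPoly (D K)) :
    polyMk K (DiffPoly.mulC (D K) a p) = DiffPoly.mulC (DR K) (a : R K) (polyMk K p) := by
  have : (polyMk K).comp (DiffPoly.mulC (D K) a)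
      = (DiffPoly.mulC (DR K) (a : R K)).comp (polyMk K) := DiffPoly.addHom_ext fun j b => by
    simp only [AddMonoidHom.comp_apply, DiffPoly.mulC_monomial, polyMk_monomial]
    rfl
  exact DFunLike.congr_fun this p

theorem polyMk_surjective : Function.Surjective (polyMk K) := by
  rintro ⟨c⟩
  induction c using Finsupp.induction_linear with
  | zero => exact ⟨0, map_zero _⟩
  | add c d hc hd =>
    obtain ⟨p, hp⟩ := hc
    obtain ⟨q, hq⟩ := hd
    exact ⟨p + q, by rw [map_add, hp, hq]; rfl⟩
  | single j a =>
    induction a using Quotient.inductionOn' with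
    | h a => exact ⟨DiffPoly.monomial (D K) j a, polyMk_monomial K j a⟩

theorem coeff_polyMk (p : DiffPoly (D K)) (j : ℕ) :
    (polyMk K p).coeff j = (p.coeff j : R K) := by
  obtain ⟨c⟩ := p
  induction c using Finsupp.induction_linear with
  | zero => rfl
  | add c d hc hd =>
    have e : (⟨c + d⟩ : DiffPoly (D K)) = ⟨c⟩ + ⟨d⟩ := rfl
    rw [e, map_add, DiffPoly.coeff_add, Finsupp.add_apply, hc, hd]
    rfl
  | single i a =>
    change (polyMk K (DiffPoly.monomial (D K) i a)).coeff j = _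
    rw [polyMk_monomial]
    classical
    simp only [DiffPoly.monomial, Finsupp.single_apply]
    split_ifs <;> rfl

theorem coe_eq_zero_iff {a : A K} : (a : R K) = 0 ↔ a ∈ I K := by
  rw [TwoSidedIdeal.mem_iff]
  exact RingCon.eq _

/-- All coefficients of `p` lie in `I`, and powers of `X` only contribute powers of the outer node
`n`. -/
theorem evalPoly_mem_deficient {p : DiffPoly (D K)} (hp : polyMk K p = 0) (s n : ℕ) :
    evalPoly (node K) s n p ∈ deficient K s n := by
  rw [evalPoly_eq_sum]
  refine sum_mem fun j _ => ?_
  dsimp only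
  rw [mul_comm]
  refine mul_mem_deficient (pow_mem (node_mem_outer (Or.inr le_rfl)) _) ?_
  refine (mem_deficientIdeal K).1 (I_le_deficientIdeal K ((coe_eq_zero_iff K).1 ?_)) s n
  rw [← coeff_polyMk, hp]
  rfl

theorem x0X_mul (q : DiffPoly (DR K)) :
    x0X K * q = DiffPoly.mulC (DR K) ((x K 0 : A K) : R K) (DiffPoly.mulX (DR K) q) := by
  rw [DiffPoly.mul_def, x0X, DiffPoly.mulHom_monomial]
  rfl

theorem not_isQuasiregular_x0X : ¬ IsQuasiregular (x0X K) := by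
  intro h
  obtain ⟨y, hy, -⟩ := isQuasiregular_iff.1 h
  obtain ⟨p, rfl⟩ := polyMk_surjective K y
  have hp : polyMk K (p + DiffPoly.monomial (D K) 1 (x K 0)
      + DiffPoly.mulC (D K) (x K 0) (DiffPoly.mulX (D K) p)) = 0 := by
    rw [map_add, map_add, polyMk_mulC, polyMk_mulX, ← x0X_mul, polyMk_monomial]
    exact hy
  -- The geometric series modulo deficient polynomials, with `n` fixed and `s` descending from `n -
  -- 1`; the sign alternates with `d`.
  have key : ∀ d n s, s + (d + 1) = n → ∃ ε : MvPolynomial (ℕ × ℕ) K, (ε = 1 ∨ ε = -1) ∧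
      ∏ l ∈ Finset.Ioc s n, node K l + ε * evalPoly (node K) s n p ∈ deficient K s n := by
    intro d n
    induction d with
    | zero =>
      intro s hs
      have hmem := evalPoly_mem_deficient K hp s n
      subst hs
      refine ⟨1, Or.inl rfl, ?_⟩
      rw [map_add, map_add, evalPoly_mulC_x, evalPoly_self, evalPoly_monomial, x, eval_mon] at hmem
      simpa [letters, evalWord, FreeSemigroup.of, FreeSemigroup.length, add_comm] using hmem
    | succ d ih =>
      intro s hs
      obtain ⟨ε, hε, h⟩ := ih (s + 1) (by omega)
      have hmem := evalPoly_mem_deficient K hp s n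
      have hx : eval K (node K) s n (x K 0) = 0 := by
        rw [x, eval_mon, if_neg]
        simp [FreeSemigroup.of, FreeSemigroup.length]; omega
      -- Off the first superdiagonal `x₀X` has no entry, so the entry of `p` at `(s, n)` is minus
      -- `node K (s + 1)` times its entry at `(s + 1, n)`, modulo deficient polynomials.
      rw [map_add, map_add, evalPoly_mulC_x, evalPoly_mulX, evalPoly_monomial, hx, zero_mul,
        add_zero] at hmem
      have h2 := deficient_mono (Nat.le_succ s) le_rfl
        (mul_mem_deficient (node_mem_outer (Or.inl le_rfl)) h)
      have e : Finset.Ioc s n = insert (s + 1) (Finset.Ioc (s + 1) n) := by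
        ext a; simp only [Finset.mem_Ioc, Finset.mem_insert]; omega
      refine ⟨-ε, by rcases hε with rfl | rfl <;> simp, ?_⟩
      rw [e, Finset.prod_insert (by simp)]
      rcases hε with rfl | rfl
      · convert sub_mem h2 hmem using 1; ring
      · convert add_mem h2 hmem using 1; ring
  -- Finitely many words occur in `p`, so beyond some column its row 0 is zero and the bare product
  -- of nodes would be deficient.
  obtain ⟨N, hN⟩ := evalPoly_eventually_zero (node K) p
  obtain ⟨ε, -, h⟩ := key N (N + 1) 0 (by omega)
  rw [hN (N + 1) (by omega), mul_zero, add_zero] at h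
  exact prod_node_notMem_deficient _ h

end Quotient

/-! ### Local nilpotency of `R` -/

section LocallyNilpotent

variable (K : Type*) [Field K]

/-- The span of the words of length at least `n` in the letters below `k`. -/
noncomputable def longWords (k n : ℕ) : Submodule K (A K) :=
  Submodule.span K {a | ∃ w : FreeSemigroup ℕ,
    n ≤ w.length ∧ (∀ i ∈ letters w, i < k) ∧ a = mon K w}

theorem mul_mem_longWords {k m n : ℕ} {a b : A K} (ha : a ∈ longWords K k m)
    (hb : b ∈ longWords K k n) : a * b ∈ longWords K k (m + n) := by
  induction ha using Submodule.span_induction with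
  | zero => rw [zero_mul]; exact zero_mem _
  | add a a' _ _ ha ha' => rw [add_mul]; exact add_mem ha ha'
  | smul c a _ ha => rw [smul_mul_assoc]; exact Submodule.smul_mem _ _ ha
  | mem a ha =>
    obtain ⟨v, hv, hvk, rfl⟩ := ha
    induction hb using Submodule.span_induction with
    | zero => rw [mul_zero]; exact zero_mem _
    | add b b' _ _ hb hb' => rw [mul_add]; exact add_mem hb hb'
    | smul c b _ hb => rw [mul_smul_comm]; exact Submodule.smul_mem _ _ hb
    | mem b hb =>
      obtain ⟨w, hw, hwk, rfl⟩ := hb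
      refine Submodule.subset_span ⟨v * w, ?_, fun i hi => ?_, (mon_mul v w).symm⟩
      · rw [FreeSemigroup.length_mul]; exact Nat.add_le_add hv hw
      · rw [letters_mul, List.mem_append] at hi
        exact hi.elim (hvk i) (hwk i)

theorem longWords_mono {k k' m n : ℕ} (hk : k ≤ k') (hmn : n ≤ m) :
    longWords K k m ≤ longWords K k' n :=
  Submodule.span_mono fun _ ⟨w, h1, h2, h3⟩ =>
    ⟨w, hmn.trans h1, fun i hi => (h2 i hi).trans_le hk, h3⟩

theorem exists_mem_longWords (a : A K) : ∃ k, a ∈ longWords K k 1 := by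
  induction a using mon_induction with
  | h0 => exact ⟨0, zero_mem _⟩
  | hadd a b ha hb =>
    obtain ⟨k, hk⟩ := ha
    obtain ⟨k', hk'⟩ := hb
    exact ⟨max k k', add_mem (longWords_mono K (le_max_left _ _) le_rfl hk)
      (longWords_mono K (le_max_right _ _) le_rfl hk')⟩
  | hsmul c w =>
    refine ⟨(letters w).sum + 1, Submodule.smul_mem _ _ (Submodule.subset_span
      ⟨w, Nat.le_add_left _ _, fun i hi => Nat.lt_succ_of_le (List.le_sum_of_mem hi), rfl⟩)⟩

theorem smul_mon_mem_I {k : ℕ} (hk : 0 < k) (c : K) (w : FreeSemigroup ℕ) (hw : ∀ i ∈ letters w, i < k)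
    (hlen : 2 * 100 ^ k ^ 2 ≤ w.length) : c • mon K w ∈ I K := by
  have hle : Ik K k ≤ I K := le_iSup (fun k : {k : ℕ // 0 < k} => Ik K k) ⟨k, hk⟩
  have hmem : ∀ v : FreeSemigroup ℕ, (∀ i ∈ letters v, i < k) → v.length = 2 * 100 ^ k ^ 2 →
      c • mon K v ∈ I K := fun v hv hl => hle (TwoSidedIdeal.subset_span
    (Submodule.smul_mem _ _ (Submodule.subset_span (Set.mem_iUnion.2 ⟨0, v, hl, hv, rfl⟩))))
  obtain ⟨i, l⟩ := w
  set N := 2 * 100 ^ k ^ 2 with hN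
  have hpos : 0 < N := by positivity
  have hlen' : N ≤ l.length + 1 := hlen
  rcases h : l.drop (N - 1) with _ | ⟨j, l'⟩
  · have := List.drop_eq_nil_iff.1 h
    exact hmem _ hw (by change l.length + 1 = N; omega)
  · have e : (⟨i, l⟩ : FreeSemigroup ℕ) = ⟨i, l.take (N - 1)⟩ * ⟨j, l'⟩ := by
      change _ = (⟨i, l.take (N - 1) ++ j :: l'⟩ : FreeSemigroup ℕ)
      rw [← h, List.take_append_drop]
    -- The scalar goes to the prefix, where the `K`-span in the definition of `Ik` absorbs it.
    rw [e, mon_mul, ← smul_mul_assoc]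
    refine (I K).mul_mem_right _ _ (hmem _ (fun a ha => hw a ?_) ?_)
    · rw [e, letters_mul]; exact List.mem_append_left _ ha
    · change (l.take (N - 1)).length + 1 = N
      rw [List.length_take]; omega

theorem longWords_subset_I {k n : ℕ} (hk : 0 < k) (hn : 2 * 100 ^ k ^ 2 ≤ n) {a : A K}
    (ha : a ∈ longWords K k n) : a ∈ I K := by
  have key : ∀ a ∈ longWords K k n, ∀ c : K, c • a ∈ I K := by
    intro a ha
    induction ha using Submodule.span_induction with
    | zero => intro c; rw [smul_zero]; exact (I K).zero_mem
    | add a b _ _ ha hb => intro c; rw [smul_add]; exact (I K).add_mem (ha c) (hb c)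
    | smul d a _ ha => intro c; rw [smul_smul]; exact ha _
    | mem a ha =>
      obtain ⟨w, hw, hwk, rfl⟩ := ha
      exact fun c => smul_mon_mem_I K hk c w hwk (hn.trans hw)
  simpa using key a ha 1

theorem exists_longWords_lift (s : Finset (R K)) :
    ∃ k, ∀ r ∈ s, ∃ a ∈ longWords K k 1, (a : R K) = r := by
  classical
  induction s using Finset.induction_on with
  | empty => exact ⟨0, by simp⟩
  | insert r s _ ih =>
    obtain ⟨k, hk⟩ := ih
    induction r using Quotient.inductionOn' with
    | h a =>
      obtain ⟨k', hk'⟩ := exists_mem_longWords K a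
      refine ⟨max k k', fun r hr => ?_⟩
      rcases Finset.mem_insert.1 hr with rfl | hr
      · exact ⟨a, longWords_mono K (le_max_right _ _) le_rfl hk', rfl⟩
      · obtain ⟨b, hb, rfl⟩ := hk r hr
        exact ⟨b, longWords_mono K (le_max_left _ _) le_rfl hb, rfl⟩

theorem isLocallyNilpotentRing_R : IsLocallyNilpotentRing (R K) := by
  intro s
  obtain ⟨k, hk⟩ := exists_longWords_lift K s
  have hclosure : ∀ r ∈ NonUnitalSubring.closure (s : Set (R K)),
      ∃ a ∈ longWords K k 1, (a : R K) = r := by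
    intro r hr
    induction hr using NonUnitalSubring.closure_induction with
    | mem r hr => exact hk r hr
    | zero => exact ⟨0, zero_mem _, rfl⟩
    | add _ _ _ _ hr ht =>
      obtain ⟨a, ha, rfl⟩ := hr
      obtain ⟨b, hb, rfl⟩ := ht
      exact ⟨a + b, add_mem ha hb, rfl⟩
    | neg _ _ hr =>
      obtain ⟨a, ha, rfl⟩ := hr
      exact ⟨-a, neg_mem ha, rfl⟩
    | mul _ _ _ _ hr ht =>
      obtain ⟨a, ha, rfl⟩ := hr
      obtain ⟨b, hb, rfl⟩ := ht
      exact ⟨a * b, longWords_mono K le_rfl (by norm_num) (mul_mem_longWords K ha hb), rfl⟩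
  have hfold : ∀ (l : List (NonUnitalSubring.closure (s : Set (R K)))) (m : ℕ)
      (r : NonUnitalSubring.closure (s : Set (R K))),
      (∃ a ∈ longWords K k m, (a : R K) = r) →
      ∃ a ∈ longWords K k (m + l.length), (a : R K) = (l.foldl (· * ·) r : _) := by
    intro l
    induction l with
    | nil => exact fun m r h => h
    | cons t l ih =>
      rintro m r ⟨a, ha, har⟩
      obtain ⟨b, hb, hbt⟩ := hclosure t t.2
      have := ih (m + 1) (r * t) ⟨a * b, mul_mem_longWords K ha hb, by
        change _ = (r : R K) * (t : R K)
        rw [← har, ← hbt]; rfl⟩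
      rwa [add_assoc, add_comm 1] at this
  -- `k + 1` replaces `k`, which may be 0, because only the ideals of positive index are summed in
  -- `I`.
  refine ⟨2 * 100 ^ (k + 1) ^ 2, fun r l hl => Subtype.ext ?_⟩
  obtain ⟨a, ha, har⟩ := hfold l 1 r (hclosure r r.2)
  rw [← har]
  exact (coe_eq_zero_iff K).2 (longWords_subset_I K (Nat.succ_pos k) (by rw [hl]; exact Nat.le_add_left _ _)
    (longWords_mono K (Nat.le_succ k) le_rfl ha))

end LocallyNilpotent

end Shestakov

theorem mainTheorem1 :
    (∃ (R : Type) (_ : NonUnitalRing R) (D : RingDerivation R),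
      IsLocallyNilpotentRing R ∧ ¬ IsJacobsonRadicalRing (DiffPoly D)) ∧
    ∀ (K : Type*) [Field K],
      (∀ a ∈ Shestakov.I K, Shestakov.D K a ∈ Shestakov.I K) ∧
      IsLocallyNilpotentRing (Shestakov.R K) ∧
      ¬ IsQuasiregular (Shestakov.x0X K) ∧
      ¬ IsJacobsonRadicalRing (DiffPoly (Shestakov.DR K)) := by
  exact ⟨⟨Shestakov.R ℚ, inferInstance, Shestakov.DR ℚ, Shestakov.isLocallyNilpotentRing_R ℚ,
      fun h => Shestakov.not_isQuasiregular_x0X ℚ (h _)⟩,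
    fun K _ => ⟨Shestakov.D_mem_I K, Shestakov.isLocallyNilpotentRing_R K,
      Shestakov.not_isQuasiregular_x0X K,
      fun h => Shestakov.not_isQuasiregular_x0X K (h _)⟩⟩
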